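/- All graphs are finite and simple. For a graph $G$, let $\mathcal I(G)$ be the family of independent sets of $G$. A fractional colouring of $G$ is a map $f:\mathcal I(G)\to[0,1]$ with $\sum_{I\in\mathcal I(G),\,v\in I} f(I)\ge 1$ for every vertex $v$; its weight is $\sum_{I\in\mathcal I(G)} f(I)$, and the fractional chromatic number $\chi_f(G)$ is the minimum weight of a fractional colouring of $G$. For an integer $n\ge 1$, the $n$th cone $\Delta_n(G)$ is the graph with vertex set $(V(G)\times\{0,1,\dots,n-1\})\cup\{\star\}$ and edge set $\{(x,i)(y,j): xy\in E(G),\ |i-j|=1 \text{ or } i=j=0\}\cup\{(x,n-1)\star : x\in V(G)\}$. For a graph $H$ with at least one vertex and a map $h$ from $V(H)$ to the positive integers, the $(H,h)$-cone $\Delta_{H,h}(G)$ is obtained from the disjoint union of copies $\Delta_{h(v)}(G)\times\{v\}$, $v\in V(H)$, of the cones $\Delta_{h(v)}(G)$ by identifying, for each $x\in V(G)$, the vertices $((x,0),v)$, $v\in V(H)$, into a single vertex, and adding the edges $(\star,v)(\star,v')$ for $vv'\in E(H)$. **Theorem.** Let $G$ be a graph with at least one edge, let $v_1,v_2$ be the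 vertices of the complete graph $K_2$, and let $h$ be a map from $V(K_2)$ to the positive integers with $h(v_2)\ge h(v_1)=n$, where, in the constant case $h(v_1)=h(v_2)=n$, the integer $n$ is assumed to be even. Then $$\chi_f(\Delta_{K_2,h}(G))=\chi_f(\Delta_n(G)).$$ -/

import Mathlib

namespace GeneralizedCone

/-- The family `𝓘(G)` of independent sets of a graph `G` on a finite vertex set. -/
abbrev IndepFamily {V : Type*} (G : SimpleGraph V) : Type _ :=
  {I : Finset V // G.IsIndepSet (I : Set V)}

open Classical in
/-- `f : 𝓘(G) → [0,1]` is a fractional colouring of `G`: for every vertex `v`, the values of `f`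
on the independent sets that contain `v` add up to at least `1`. -/
def IsFractionalColouring {V : Type*} [Fintype V] (G : SimpleGraph V)
    (f : IndepFamily G → ℝ) : Prop :=
  (∀ I, f I ∈ Set.Icc (0 : ℝ) 1) ∧
    ∀ v : V, 1 ≤ ∑ I : IndepFamily G, if v ∈ I.1 then f I else 0

open Classical in
/-- The weight of a real function on the independent sets of `G`. -/
noncomputable def weight {V : Type*} [Fintype V] (G : SimpleGraph V)
    (f : IndepFamily G → ℝ) : ℝ :=
  ∑ I : IndepFamily G, f I

/-- The fractional chromatic number `χ_f(G)` of a finite graph: the minimum weight of a fractional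
colouring. It is written as an infimum, which is attained, see `fracChromatic_isLeast`. -/
noncomputable def fracChromatic {V : Type*} [Fintype V] (G : SimpleGraph V) : ℝ :=
  sInf (weight G '' {f | IsFractionalColouring G f})

theorem fracChromatic_isLeast {V : Type*} [Fintype V] (G : SimpleGraph V) :
    IsLeast (weight G '' {f | IsFractionalColouring G f}) (fracChromatic G) := by
  classical
  have hcomp : IsCompact {f | IsFractionalColouring G f} := by
    have hbox : IsCompact (Set.univ.pi fun _ : IndepFamily G => Set.Icc (0 : ℝ) 1) :=
      isCompact_univ_pi fun _ => isCompact_Icc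
    refine hbox.of_isClosed_subset ?_ fun f hf I _ => hf.1 I
    have hset : {f | IsFractionalColouring G f} =
        (⋂ I : IndepFamily G, {f | f I ∈ Set.Icc (0 : ℝ) 1}) ∩
          ⋂ v : V, {f | 1 ≤ ∑ I : IndepFamily G, if v ∈ I.1 then f I else 0} := by
      ext f
      simp only [Set.mem_inter_iff, Set.mem_iInter]
      exact Iff.rfl
    rw [hset]
    refine (isClosed_iInter fun I => isClosed_Icc.preimage (continuous_apply I)).inter
      (isClosed_iInter fun v => isClosed_le continuous_const
        (continuous_finsetSum _ fun I _ => ?_))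
    split_ifs
    · exact continuous_apply I
    · exact continuous_const
  have hne : {f | IsFractionalColouring G f}.Nonempty := by
    refine ⟨fun _ => 1, fun _ => by simp, fun v => ?_⟩
    have hv : G.IsIndepSet (({v} : Finset V) : Set V) := by simp [SimpleGraph.IsIndepSet]
    have := Finset.single_le_sum (s := Finset.univ)
      (f := fun I : IndepFamily G => if v ∈ I.1 then (1 : ℝ) else 0)
      (fun I _ => by split_ifs <;> norm_num) (Finset.mem_univ ⟨{v}, hv⟩)
    simpa using this
  have hcont : Continuous (weight G) :=
    continuous_finsetSum _ fun I _ => continuous_apply I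
  exact (hcomp.image hcont).isLeast_sInf (hne.image _)

/-- Vertices of the `n`-th cone over a graph on `V`: `some (x, i)` is `(x, i)`, in layer `i`,
and `none` is the apex `⋆`. -/
abbrev ConeVertex (V : Type*) (n : ℕ) : Type _ := Option (V × Fin n)

/-- The adjacency of the `n`-th cone: `(x, i)` and `(y, j)` are adjacent when `xy` is an edge and
`|i - j| = 1` or `i = j = 0`; the apex is adjacent exactly to the layer `n - 1`. -/
def ConeAdj {V : Type*} (G : SimpleGraph V) (n : ℕ) : ConeVertex V n → ConeVertex V n → Prop
  | some (x, i), some (y, j) =>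
      G.Adj x y ∧ (i.val + 1 = j.val ∨ j.val + 1 = i.val ∨ (i.val = 0 ∧ j.val = 0))
  | some (_, i), none => i.val + 1 = n
  | none, some (_, j) => j.val + 1 = n
  | none, none => False

/-- The `n`-th cone `Δ_n(G)` over `G` (for `n ≥ 1`). -/
def cone {V : Type*} (G : SimpleGraph V) (n : ℕ) : SimpleGraph (ConeVertex V n) where
  Adj := ConeAdj G n
  symm := ⟨by
    rintro (_ | ⟨x, i⟩) (_ | ⟨y, j⟩) h
    · exact h
    · exact h
    · exact h
    · exact ⟨h.1.symm, by have := h.2; tauto⟩⟩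
  loopless := ⟨by
    rintro (_ | ⟨x, i⟩) h
    · exact h
    · exact G.loopless.irrefl x h.1⟩

/-- Vertices of the `(H, h)`-cone over a graph on `V`, where `H` has vertex set `W`: the common
base (a copy of `V`), for every `v : W` the layers `1, …, h v - 1` of the copy of `Δ_{h v}(G)`
that belongs to `v`, and for every `v : W` an apex `(⋆, v)`. -/
abbrev HConeVertex (V : Type*) {W : Type*} (h : W → ℕ) : Type _ :=
  V ⊕ (Σ v : W, V × Fin (h v - 1)) ⊕ W

/-- The vertex of the `(H, h)`-cone that a vertex of the copy of `Δ_{h v}(G)` belonging to `v`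
becomes when the bases of all the copies are identified. -/
def glue {V W : Type*} (h : W → ℕ) (v : W) : ConeVertex V (h v) → HConeVertex V h
  | none => Sum.inr (Sum.inr v)
  | some (x, ⟨0, _⟩) => Sum.inl x
  | some (x, ⟨i + 1, hi⟩) => Sum.inr (Sum.inl ⟨v, x, ⟨i, Nat.lt_sub_of_add_lt hi⟩⟩)

/-- The `(H, h)`-cone `Δ_{H,h}(G)` over `G` (for `H` with at least one vertex and `h ≥ 1`): the
edges are those of the copies of the cones `Δ_{h v}(G)`, and the edges of `H` between apexes. -/
def hCone {V W : Type*} (G : SimpleGraph V) (H : SimpleGraph W) (h : W → ℕ) :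
    SimpleGraph (HConeVertex V h) where
  Adj a b :=
    (∃ (v : W) (p q : ConeVertex V (h v)),
      (cone G (h v)).Adj p q ∧ glue h v p = a ∧ glue h v q = b) ∨
    (∃ v v' : W, H.Adj v v' ∧ glue h v none = a ∧ glue h v' none = b)
  symm := ⟨by
    rintro a b (⟨v, p, q, hpq, rfl, rfl⟩ | ⟨v, v', hv, rfl, rfl⟩)
    · exact Or.inl ⟨v, q, p, hpq.symm, rfl, rfl⟩
    · exact Or.inr ⟨v', v, hv.symm, rfl, rfl⟩⟩
  loopless := ⟨by
    rintro a (⟨v, p, q, hpq, rfl, hq⟩ | ⟨v, v', hv, rfl, hv'⟩)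
    · have : q = p := by
        rcases p with _ | ⟨x, ⟨_ | i, hi⟩⟩ <;> rcases q with _ | ⟨y, ⟨_ | j, hj⟩⟩ <;>
          simp_all [glue]
      subst this
      exact (cone G (h v)).loopless.irrefl _ hpq
    · have : v' = v := by simpa [glue] using hv'
      subst this
      exact H.loopless.irrefl _ hv⟩

end GeneralizedCone

/- Since `Δ_n(G)` is one of the two cones that form the double cone `Δ_{K₂,h}(G)`, only `χ_f` of the
double cone has to be bounded from above.

If the second cone is higher than `n`, its lower layers fold onto the base and its top layer
contracts to the apex of `Δ_n(G)`. This maps the double cone to `Δ_n(G)` with a pendant vertex, and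
pendant vertices do not increase a fractional chromatic number that is at least `2`.

If both cones have the even height `n`, write `s = χ_f(G) - 1` and `σ = 1 + s + ⋯ + s ^ (n - 1)`.
The number `χ_f(G) + 1 / σ` separates the two sides. A cover of `Δ_n(G)` by independent sets is cut,
layer by layer and with geometric weights, into a cover of `G`; since every independent set
containing the apex saves one slice, this gives `χ_f(Δ_n(G)) ≥ χ_f(G) + 1 / σ`. Conversely, an
optimal colouring of `G` yields a colouring of the double cone of weight `χ_f(G) + 1 / σ`: each set
agrees with an independent set of `G` below a level `k` and contains everything at the heights
`k + 1, k + 3, …`, so that it contains the apex only if `k` is odd, and the levels in the two cones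
are never odd at the same time. -/

namespace GeneralizedCone

section FractionalCover

variable {V W ι κ : Type*} [Fintype ι] [Fintype κ]

/-- The total weight with which the sets `K i`, taken with the weights `c i`, cover the point `v`.
It plays the role of the sum over the independent sets containing `v` in a fractional colouring. -/
noncomputable def coverage (K : ι → Set V) (c : ι → ℝ) (v : V) : ℝ :=
  ∑ i, c i * (K i).indicator 1 v

/-- The independent sets `K i` of `G`, taken with the nonnegative weights `c i`, cover every vertex
at least `m` times. In contrast to `IsFractionalColouring`, sets may repeat and the weights need not
be at most `1`, which leaves room for explicit constructions. -/
structure IsFractionalCover (G : SimpleGraph V) (K : ι → Set V) (c : ι → ℝ) (m : ℝ) : Prop where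
  isIndepSet : ∀ i, G.IsIndepSet (K i)
  nonneg : ∀ i, 0 ≤ c i
  le_coverage : ∀ v, m ≤ coverage K c v

theorem mul_indicator_one_nonneg {a : ℝ} (ha : 0 ≤ a) (A : Set V) (v : V) :
    0 ≤ a * A.indicator 1 v :=
  mul_nonneg ha (Set.indicator_nonneg (fun _ _ => zero_le_one) v)

theorem coverage_nonneg {c : ι → ℝ} (hc : ∀ i, 0 ≤ c i) (K : ι → Set V) (v : V) :
    0 ≤ coverage K c v :=
  Finset.sum_nonneg fun i _ => mul_indicator_one_nonneg (hc i) (K i) v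

theorem coverage_eq_sum {K : ι → Set V} {v : V} (hv : ∀ i, v ∈ K i) (c : ι → ℝ) :
    coverage K c v = ∑ i, c i :=
  Finset.sum_congr rfl fun i _ => by simp [hv i]

theorem coverage_le_coverage {c : ι → ℝ} (hc : ∀ i, 0 ≤ c i) {K : ι → Set V} {L : ι → Set W}
    {v : V} {w : W} (hKL : ∀ i, v ∈ K i → w ∈ L i) : coverage K c v ≤ coverage L c w := by
  refine Finset.sum_le_sum fun i _ => ?_
  by_cases hv : v ∈ K i
  · simp [hv, hKL i hv]
  · simpa [hv] using mul_indicator_one_nonneg (hc i) (L i) w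

theorem coverage_congr {K : ι → Set V} {L : ι → Set W} {v : V} {w : W}
    (hKL : ∀ i, v ∈ K i ↔ w ∈ L i) (c : ι → ℝ) : coverage K c v = coverage L c w :=
  Finset.sum_congr rfl fun i _ => by by_cases hv : v ∈ K i <;> simp [hv, ← hKL i]

theorem coverage_add_coverage_eq_sum {K : ι → Set V} {L : ι → Set W} {v : V} {w : W}
    (hKL : ∀ i, w ∈ L i ↔ v ∉ K i) (c : ι → ℝ) :
    coverage K c v + coverage L c w = ∑ i, c i := by
  rw [coverage, coverage, ← Finset.sum_add_distrib]
  exact Finset.sum_congr rfl fun i _ => by by_cases hv : v ∈ K i <;> simp [hv, hKL i]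

theorem coverage_mul (K : ι × κ → Set V) (a : ι → ℝ) (b : κ → ℝ) (v : V) :
    coverage K (fun p => a p.1 * b p.2) v = ∑ i, a i * coverage (fun j => K (i, j)) b v := by
  simp only [coverage, Fintype.sum_prod_type, Finset.mul_sum, mul_assoc]

theorem IsFractionalCover.comap {G : SimpleGraph V} {H : SimpleGraph W} {K : ι → Set W}
    {c : ι → ℝ} {m : ℝ} (hK : IsFractionalCover H K c m) (φ : G →g H) :
    IsFractionalCover G (fun i => φ ⁻¹' K i) c m where
  isIndepSet i _ hx _ hy _ hxy :=
    hK.isIndepSet i hx hy (φ.map_adj hxy).ne (φ.map_adj hxy)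
  nonneg := hK.nonneg
  le_coverage v := hK.le_coverage (φ v)

theorem IsFractionalCover.coverage_add_coverage_le {G : SimpleGraph V} {K : ι → Set V}
    {c : ι → ℝ} {m : ℝ} (hK : IsFractionalCover G K c m) {x y : V} (hxy : G.Adj x y) :
    coverage K c x + coverage K c y ≤ ∑ i, c i := by
  rw [coverage, coverage, ← Finset.sum_add_distrib]
  refine Finset.sum_le_sum fun i _ => ?_
  have hi := hK.nonneg i
  by_cases hx : x ∈ K i
  · have hy : y ∉ K i := fun hy => hK.isIndepSet i hx hy hxy.ne hxy
    simp [hx, hy]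
  · by_cases hy : y ∈ K i <;> simp [hx, hy, hi]

/- Every set containing `a` is split between itself and its part without `a`, in the proportion
that brings the coverage of `a` down to `1`. -/
theorem IsFractionalCover.exists_coverage_eq_one {G : SimpleGraph V} {K : ι → Set V}
    {c : ι → ℝ} (hK : IsFractionalCover G K c 1) (a : V) :
    ∃ (L : ι ⊕ ι → Set V) (d : ι ⊕ ι → ℝ),
      IsFractionalCover G L d 1 ∧ ∑ i, d i = ∑ i, c i ∧ coverage L d a = 1 := by
  set C := coverage K c a with hC
  have hC1 : 1 ≤ C := hK.le_coverage a
  have hC0 : C ≠ 0 := by positivity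
  have hinv : C⁻¹ ≤ 1 := inv_le_one_of_one_le₀ hC1
  let L : ι ⊕ ι → Set V := Sum.elim K fun i => K i \ {a}
  let d : ι ⊕ ι → ℝ := Sum.elim (fun i => c i * C⁻¹) fun i => c i * (1 - C⁻¹)
  have ha : coverage L d a = 1 := by
    have hK' : coverage L d a = C * C⁻¹ := by
      simp [coverage, L, d, hC, Finset.sum_mul, mul_right_comm]
    rw [hK', mul_inv_cancel₀ hC0]
  have hne : ∀ v ≠ a, coverage L d v = coverage K c v := fun v hv => by
    simp only [coverage, L, d, Fintype.sum_sum_type, Sum.elim_inl, Sum.elim_inr,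
      ← Finset.sum_add_distrib]
    refine Finset.sum_congr rfl fun i _ => ?_
    have hiff : v ∈ K i \ {a} ↔ v ∈ K i := by simp [hv]
    by_cases hvi : v ∈ K i
    · simp only [hvi, hiff, Set.indicator_of_mem, Pi.one_apply]
      ring
    · simp [hvi, hiff]
  refine ⟨L, d, ⟨?_, ?_, fun v => ?_⟩, ?_, ha⟩
  · rintro (i | i)
    · exact hK.isIndepSet i
    · exact (hK.isIndepSet i).mono Set.sdiff_subset
  · rintro (i | i)
    · exact mul_nonneg (hK.nonneg i) (inv_nonneg.2 (zero_le_one.trans hC1))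
    · exact mul_nonneg (hK.nonneg i) (sub_nonneg.2 hinv)
  · obtain rfl | hv := eq_or_ne v a
    · exact ha.ge
    · exact (hne v hv).symm ▸ hK.le_coverage v
  · simp only [d, Fintype.sum_sum_type, Sum.elim_inl, Sum.elim_inr, ← Finset.sum_add_distrib]
    exact Finset.sum_congr rfl fun i _ => by ring

end FractionalCover

section FracChromatic

variable {V W ι : Type*} [Fintype V] [Fintype W] [Fintype ι] {G : SimpleGraph V}
  {H : SimpleGraph W}

open Classical in
theorem isFractionalCover_coe_one_iff {f : IndepFamily G → ℝ} :
    IsFractionalCover G (fun I : IndepFamily G => (I.1 : Set V)) f 1 ↔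
      (∀ I, 0 ≤ f I) ∧ ∀ v, 1 ≤ ∑ I : IndepFamily G, if v ∈ I.1 then f I else 0 := by
  have hcov (v : V) : coverage (fun I : IndepFamily G => (I.1 : Set V)) f v =
      ∑ I : IndepFamily G, if v ∈ I.1 then f I else 0 :=
    Finset.sum_congr rfl fun I _ => by simp [Set.indicator_apply]
  exact ⟨fun h => ⟨h.nonneg, fun v => (h.le_coverage v).trans_eq (hcov v)⟩,
    fun h => ⟨fun I => I.2, h.1, fun v => (h.2 v).trans_eq (hcov v).symm⟩⟩

theorem exists_isFractionalCover_sum_eq_fracChromatic.{u} {V : Type u} [Fintype V]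
    (G : SimpleGraph V) :
    ∃ (ι : Type u) (_ : Fintype ι) (K : ι → Set V) (c : ι → ℝ),
      IsFractionalCover G K c 1 ∧ ∑ i, c i = fracChromatic G := by
  classical
  obtain ⟨f, hf, hweight⟩ := (fracChromatic_isLeast G).1
  exact ⟨IndepFamily G, inferInstance, _, f,
    isFractionalCover_coe_one_iff.2 ⟨fun I => (hf.1 I).1, hf.2⟩, hweight⟩

open Classical in
theorem fracChromatic_le_sum_indepFamily {f : IndepFamily G → ℝ}
    (hf : IsFractionalCover G (fun I : IndepFamily G => (I.1 : Set V)) f 1) :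
    fracChromatic G ≤ ∑ I, f I := by
  obtain ⟨hf0, hf1⟩ := isFractionalCover_coe_one_iff.1 hf
  have hmin : IsFractionalColouring G fun I => min 1 (f I) := by
    refine ⟨fun I => ⟨le_min zero_le_one (hf0 I), min_le_left _ _⟩, fun v => ?_⟩
    by_cases hbig : ∃ I : IndepFamily G, v ∈ I.1 ∧ 1 ≤ f I
    · obtain ⟨I, hvI, hI⟩ := hbig
      have hle := Finset.single_le_sum (s := Finset.univ)
        (f := fun I : IndepFamily G => if v ∈ I.1 then min 1 (f I) else 0)
        (fun I _ => by split_ifs <;> simp [hf0]) (Finset.mem_univ I)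
      simpa [hvI, hI] using hle
    · push Not at hbig
      refine (hf1 v).trans_eq (Finset.sum_congr rfl fun I _ => ?_)
      split_ifs with hv
      · exact (min_eq_right (hbig I hv).le).symm
      · rfl
  calc fracChromatic G ≤ weight G fun I => min 1 (f I) :=
        (fracChromatic_isLeast G).2 ⟨_, hmin, rfl⟩
    _ ≤ ∑ I, f I := Finset.sum_le_sum fun I _ => min_le_right _ _

theorem IsFractionalCover.mul_fracChromatic_le_sum {K : ι → Set V} {c : ι → ℝ} {m : ℝ}
    (hK : IsFractionalCover G K c m) (hm : 0 < m) : m * fracChromatic G ≤ ∑ i, c i := by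
  classical
  let L (i : ι) : IndepFamily G := ⟨(K i).toFinset, by simpa using hK.isIndepSet i⟩
  have hL (i : ι) : ((L i).1 : Set V) = K i := by simp [L]
  let f (I : IndepFamily G) : ℝ := ∑ i with L i = I, c i / m
  have hf : IsFractionalCover G (fun I : IndepFamily G => (I.1 : Set V)) f 1 := by
    refine ⟨fun I => I.2, fun I => Finset.sum_nonneg fun i _ => div_nonneg (hK.nonneg i) hm.le,
      fun v => ?_⟩
    calc (1 : ℝ) ≤ coverage K c v / m := (one_le_div hm).2 (hK.le_coverage v)
      _ = ∑ i, c i / m * ((L i).1 : Set V).indicator 1 v := by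
        rw [coverage, Finset.sum_div]
        exact Finset.sum_congr rfl fun i _ => by rw [hL]; ring
      _ = ∑ I, ∑ i with L i = I, c i / m * ((L i).1 : Set V).indicator 1 v :=
        (Finset.sum_fiberwise _ L _).symm
      _ = coverage (fun I : IndepFamily G => (I.1 : Set V)) f v := by
        refine Finset.sum_congr rfl fun I _ => ?_
        rw [Finset.sum_mul]
        exact Finset.sum_congr rfl fun i hi => by rw [(Finset.mem_filter.1 hi).2]
  calc m * fracChromatic G ≤ m * ∑ I, f I :=
        mul_le_mul_of_nonneg_left (fracChromatic_le_sum_indepFamily hf) hm.le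
    _ = ∑ i, c i := by
      rw [Finset.sum_fiberwise, ← Finset.sum_div, mul_div_cancel₀ _ hm.ne']

theorem IsFractionalCover.fracChromatic_le_sum {K : ι → Set V} {c : ι → ℝ}
    (hK : IsFractionalCover G K c 1) : fracChromatic G ≤ ∑ i, c i := by
  simpa using hK.mul_fracChromatic_le_sum one_pos

theorem fracChromatic_le_of_hom (φ : G →g H) : fracChromatic G ≤ fracChromatic H := by
  obtain ⟨ι, _, K, c, hK, hsum⟩ := exists_isFractionalCover_sum_eq_fracChromatic H
  exact hsum ▸ (hK.comap φ).fracChromatic_le_sum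

theorem two_le_fracChromatic {x y : V} (hxy : G.Adj x y) : 2 ≤ fracChromatic G := by
  obtain ⟨ι, _, K, c, hK, hsum⟩ := exists_isFractionalCover_sum_eq_fracChromatic G
  linarith [hK.coverage_add_coverage_le hxy, hK.le_coverage x, hK.le_coverage y]

end FracChromatic

section Pendant

variable {V : Type*}

/-- The graph obtained from `G` by attaching a new vertex `none` to the vertex `a` alone. When `a`
is the apex of the `n`-th cone, it receives the cones over the same graph that are higher than
`n`, with `none` as the image of their apexes. -/
def addPendant (G : SimpleGraph V) (a : V) : SimpleGraph (Option V) :=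
  G.map some ⊔ SimpleGraph.edge (some a) none

theorem addPendant_adj_some_some {G : SimpleGraph V} {a x y : V} :
    (addPendant G a).Adj (some x) (some y) ↔ G.Adj x y := by
  simpa [addPendant, SimpleGraph.edge_adj, SimpleGraph.map_adj'] using SimpleGraph.Adj.ne

theorem addPendant_adj_some_none {G : SimpleGraph V} {a x : V} :
    (addPendant G a).Adj (some x) none ↔ x = a := by
  simp [addPendant, SimpleGraph.edge_adj, SimpleGraph.map_adj']

/-- The inclusion of `G` into its extension by a pendant vertex. -/
def someHom (G : SimpleGraph V) (a : V) : G →g addPendant G a where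
  toFun := some
  map_rel' := addPendant_adj_some_some.2

theorem isIndepSet_addPendant {G : SimpleGraph V} {a : V} {A : Set (Option V)}
    (hA : G.IsIndepSet (some ⁻¹' A)) (ha : some a ∈ A → none ∉ A) :
    (addPendant G a).IsIndepSet A := by
  rintro (_ | x) hx (_ | y) hy hne hxy
  · exact hne rfl
  · exact ha (addPendant_adj_some_none.1 hxy.symm ▸ hy) hx
  · exact ha (addPendant_adj_some_none.1 hxy ▸ hx) hy
  · exact hA hx hy (fun h => hne (congrArg some h)) (addPendant_adj_some_some.1 hxy)

theorem fracChromatic_addPendant_le [Fintype V] {G : SimpleGraph V} (hG : 2 ≤ fracChromatic G)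
    (a : V) : fracChromatic (addPendant G a) ≤ fracChromatic G := by
  obtain ⟨ι, _, _, _, hf, hsum⟩ := exists_isFractionalCover_sum_eq_fracChromatic G
  obtain ⟨K, c, hK, hc, ha⟩ := hf.exists_coverage_eq_one a
  let L (i : ι ⊕ ι) : Set (Option V) := {p | p.elim (a ∉ K i) (· ∈ K i)}
  have hL : IsFractionalCover (addPendant G a) L c 1 := by
    refine ⟨fun i => isIndepSet_addPendant (hK.isIndepSet i) fun hi hi' => hi' hi, hK.nonneg, ?_⟩
    rintro (_ | v)
    · have hadd : coverage K c a + coverage L c none = ∑ i, c i :=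
        coverage_add_coverage_eq_sum (fun i => Iff.rfl) c
      linarith
    · exact (hK.le_coverage v).trans_eq (coverage_congr (fun i => Iff.rfl) c)
  rw [← hsum, ← hc]
  exact hL.fracChromatic_le_sum

end Pendant

section Cone

variable {V : Type*} {G : SimpleGraph V} {m n : ℕ}

/-- The height of a vertex of the `n`-th cone: the layer it lies in, the apex being placed at
height `n`. -/
def height : ConeVertex V n → ℕ
  | some (_, i) => i
  | none => n

theorem height_le (p : ConeVertex V n) : height p ≤ n := by
  rcases p with _ | ⟨_, i⟩
  · exact le_rfl
  · exact i.isLt.le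

theorem height_of_cone_adj {p q : ConeVertex V n} (hpq : (cone G n).Adj p q) :
    height p + 1 = height q ∨ height q + 1 = height p ∨ height p = 0 ∧ height q = 0 := by
  rcases p with _ | ⟨x, i⟩ <;> rcases q with _ | ⟨y, j⟩
  · exact hpq.elim
  · exact Or.inr (Or.inl hpq)
  · exact Or.inl hpq
  · exact hpq.2

theorem two_le_fracChromatic_cone [Fintype V] [Nonempty V] (G : SimpleGraph V) (hn : 1 ≤ n) :
    2 ≤ fracChromatic (cone G n) := by
  obtain ⟨x⟩ := ‹Nonempty V›
  have hadj : (cone G n).Adj (some (x, ⟨n - 1, by omega⟩)) none := Nat.sub_add_cancel hn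
  exact two_le_fracChromatic hadj

/-- For `1 ≤ n ≤ m`, the homomorphism from the `m`-th to the `n`-th cone that folds the lowest
layers onto the base and shifts the others down. -/
def coneFold (G : SimpleGraph V) (hn : 1 ≤ n) (hnm : n ≤ m) : cone G m →g cone G n where
  toFun p := p.map fun q => (q.1, ⟨q.2.val - (m - n), by omega⟩)
  map_rel' := by
    rintro (_ | ⟨x, i⟩) (_ | ⟨y, j⟩) hpq
    · exact hpq
    · change j.val + 1 = m at hpq
      change j.val - (m - n) + 1 = n
      omega
    · change i.val + 1 = m at hpq
      change i.val - (m - n) + 1 = n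
      omega
    · obtain ⟨hxy, hij⟩ := hpq
      refine ⟨hxy, ?_⟩
      dsimp only
      omega

/-- The homomorphism from the `(n + 1)`-st cone to the `n`-th cone with a pendant vertex at its apex
that contracts the top layer to the apex of the `n`-th cone. -/
def coneContractTop (G : SimpleGraph V) (hn : 1 ≤ n) :
    cone G (n + 1) →g addPendant (cone G n) none where
  toFun p := p.map fun q => if hq : q.2.val < n then some (q.1, ⟨q.2, hq⟩) else none
  map_rel' := by
    rintro (_ | ⟨x, i⟩) (_ | ⟨y, j⟩) hpq
    · exact hpq.elim
    · have hj : ¬ j.val < n := (Nat.succ.inj hpq).not_lt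
      simpa [hj] using (addPendant_adj_some_none.2 rfl).symm
    · have hi : ¬ i.val < n := (Nat.succ.inj hpq).not_lt
      simpa [hi] using addPendant_adj_some_none.2 rfl
    · obtain ⟨hxy, hij⟩ := hpq
      refine addPendant_adj_some_some.2 ?_
      by_cases hi : i.val < n <;> by_cases hj : j.val < n <;> simp only [hi, hj, dif_pos, dif_neg,
        not_false_eq_true]
      · exact ⟨hxy, hij⟩
      · change i.val + 1 = n
        omega
      · change j.val + 1 = n
        omega
      · omega

end Cone

section Gluing

variable {V W α : Type*} {G : SimpleGraph V} {H : SimpleGraph W} {h : W → ℕ} {n : ℕ}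

/-- The homomorphism from the cone belonging to `v` to the `(H, h)`-cone given by `glue`. -/
def glueHom (G : SimpleGraph V) (H : SimpleGraph W) (h : W → ℕ) (v : W) :
    cone G (h v) →g hCone G H h where
  toFun := glue h v
  map_rel' hpq := Or.inl ⟨v, _, _, hpq, rfl, rfl⟩

theorem exists_glue_eq [Nonempty W] (hpos : ∀ v, 0 < h v) (a : HConeVertex V h) :
    ∃ v p, glue h v p = a := by
  rcases a with x | ⟨v, x, i⟩ | v
  · obtain ⟨v⟩ := ‹Nonempty W›
    exact ⟨v, some (x, ⟨0, hpos v⟩), rfl⟩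
  · exact ⟨v, some (x, ⟨i + 1, by omega⟩), rfl⟩
  · exact ⟨v, none, rfl⟩

/-- The functions `ψ v` on the cones belonging to the vertices `v`, with common restriction `b` to
the base, glued to a function on the `(H, h)`-cone. -/
def glueLift (b : V → α) (ψ : ∀ v, ConeVertex V (h v) → α) : HConeVertex V h → α
  | Sum.inl x => b x
  | Sum.inr (Sum.inl ⟨v, x, i⟩) => ψ v (some (x, ⟨i + 1, by omega⟩))
  | Sum.inr (Sum.inr v) => ψ v none

theorem glueLift_glue {b : V → α} {ψ : ∀ v, ConeVertex V (h v) → α}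
    (hb : ∀ v x hv, ψ v (some (x, ⟨0, hv⟩)) = b x) (v : W) (p : ConeVertex V (h v)) :
    glueLift b ψ (glue h v p) = ψ v p := by
  rcases p with _ | ⟨x, ⟨_ | i, hi⟩⟩
  · rfl
  · exact (hb v x hi).symm
  · rfl

/-- Homomorphisms from the cones that agree on the base and respect the edges between the apexes,
glued to a homomorphism from the `(H, h)`-cone. -/
def hConeLift {X : SimpleGraph α} (b : V → α) (ψ : ∀ v, cone G (h v) →g X)
    (hb : ∀ v x hv, ψ v (some (x, ⟨0, hv⟩)) = b x)
    (hapex : ∀ v v', H.Adj v v' → X.Adj (ψ v none) (ψ v' none)) : hCone G H h →g X where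
  toFun := glueLift b fun v => ψ v
  map_rel' := by
    rintro _ _ (⟨v, p, q, hpq, rfl, rfl⟩ | ⟨v, v', hvv', rfl, rfl⟩)
    · simpa only [glueLift_glue hb] using (ψ v).map_adj hpq
    · simpa only [glueLift_glue hb] using hapex v v' hvv'

theorem mul_fracChromatic_hCone_le_sum {ι : Type*} [Fintype V] [Fintype W] [Nonempty W] [Fintype ι]
    (hpos : ∀ v, 0 < h v) {K : ∀ v, ι → Set (ConeVertex V (h v))} {B : ι → Set V} {c : ι → ℝ}
    {m : ℝ} (hm : 0 < m) (hK : ∀ v, IsFractionalCover (cone G (h v)) (K v) c m)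
    (hbase : ∀ v i x hv, some (x, ⟨0, hv⟩) ∈ K v i ↔ x ∈ B i)
    (hapex : ∀ v v' i, H.Adj v v' → none ∈ K v i → none ∉ K v' i) :
    m * fracChromatic (hCone G H h) ≤ ∑ i, c i := by
  let L (i : ι) : Set (HConeVertex V h) := {a | glueLift (· ∈ B i) (fun v p => p ∈ K v i) a}
  have hL (i v p) : glue h v p ∈ L i ↔ p ∈ K v i :=
    iff_of_eq (glueLift_glue (fun v x hv => propext (hbase v i x hv)) v p)
  have hcover : IsFractionalCover (hCone G H h) L c m := by
    refine ⟨?_, ?_, fun a => ?_⟩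
    · rintro i _ ha _ hb - (⟨v, p, q, hpq, rfl, rfl⟩ | ⟨v, v', hvv', rfl, rfl⟩)
      · rw [hL] at ha hb
        exact (hK v).isIndepSet i ha hb hpq.ne hpq
      · rw [hL] at ha hb
        exact hapex v v' i hvv' ha hb
    · exact (hK (Classical.arbitrary W)).nonneg
    · obtain ⟨v, p, rfl⟩ := exists_glue_eq hpos a
      exact ((hK v).le_coverage p).trans_eq (coverage_congr (fun i => (hL i v p).symm) c)
  exact hcover.mul_fracChromatic_le_sum hm

/-- A homomorphism `φ` from `H` to `H'` and the folds of the cones `Δ_{h v}(G)` onto the cones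
`Δ_{h' (φ v)}(G)` induce a homomorphism between the generalized cones. -/
def hConeMap {W' : Type*} {H' : SimpleGraph W'} {h' : W' → ℕ} (G : SimpleGraph V) (φ : H →g H')
    (hpos : ∀ w, 1 ≤ h' w) (hle : ∀ v, h' (φ v) ≤ h v) : hCone G H h →g hCone G H' h' :=
  hConeLift Sum.inl (fun v => (glueHom G H' h' (φ v)).comp (coneFold G (hpos (φ v)) (hle v)))
    (fun v x hv => by
      change glue h' (φ v) (some (x, ⟨0 - (h v - h' (φ v)), _⟩)) = Sum.inl x
      simp only [Nat.zero_sub, glue])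
    fun v v' hvv' => Or.inr ⟨φ v, φ v', φ.map_adj hvv', rfl, rfl⟩

/-- The homomorphism from the generalized cone over a graph `H` with proper `2`-colouring `κ` that
sends the cones at the vertices of colour `0` to `Δ_n(G)` and those at the vertices of colour `1`,
which are higher, to `Δ_n(G)` with a pendant vertex at its apex. -/
def hConeToPendant (G : SimpleGraph V) (κ : H.Coloring (Fin 2)) (hn : 1 ≤ n)
    (hle : ∀ v, n + (κ v).val ≤ h v) : hCone G H h →g addPendant (cone G n) none :=
  let toPendant : ∀ j : Fin 2, cone G (n + j.val) →g addPendant (cone G n) none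
    | 0 => someHom (cone G n) none
    | 1 => coneContractTop G hn
  let toPendantGlued : hCone G ⊤ (fun j : Fin 2 => n + j.val) →g addPendant (cone G n) none :=
    hConeLift (fun x => some (some (x, ⟨0, hn⟩))) toPendant
      (fun j x _ => by
        fin_cases j
        · rfl
        · exact congrArg some (dif_pos (show 0 < n from hn)))
      (fun j j' hjj' => by
        fin_cases j <;> fin_cases j'
        · exact (hjj' rfl).elim
        · exact addPendant_adj_some_none.2 rfl
        · exact (addPendant_adj_some_none.2 rfl).symm
        · exact (hjj' rfl).elim)
  toPendantGlued.comp (hConeMap G κ (fun _ => hn.trans (Nat.le_add_right n _)) hle)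

end Gluing

section UpperBound

variable {V ι : Type*} [Fintype ι] {G : SimpleGraph V} {n k : ℕ}

/-- The set of vertices of the `n`-th cone consisting of the copies of `I` in the layers below `k`
and of everything at the heights `k + 1, k + 3, …`. Such sets are the colour classes of the
fractional colouring of the double cone. -/
def layerPattern (I : Set V) (k : ℕ) : Set (ConeVertex V n) :=
  {p | (height p < k ∧ ∃ q ∈ p, q.1 ∈ I) ∨ (k < height p ∧ Odd (height p + k))}

theorem isIndepSet_layerPattern {I : Set V} (hI : G.IsIndepSet I) (k : ℕ) :
    (cone G n).IsIndepSet (layerPattern I k) := by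
  intro p hp p' hp' _ hpp'
  have hheight := height_of_cone_adj hpp'
  rcases hp with ⟨hlt, ⟨x, i⟩, rfl, hx⟩ | ⟨hgt, hodd⟩ <;>
    rcases hp' with ⟨hlt', ⟨y, j⟩, rfl, hy⟩ | ⟨hgt', hodd'⟩
  · exact hI hx hy hpp'.1.ne hpp'.1
  · omega
  · omega
  · rw [Nat.odd_iff] at hodd hodd'
    omega

theorem IsFractionalCover.le_coverage_layerPattern {L : ι → Set V} {c : ι → ℝ} {m : ℝ}
    (hL : IsFractionalCover G L c m) {p : ConeVertex V n} (hpk : height p < k) (hkn : k ≤ n) :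
    m ≤ coverage (fun i => layerPattern (L i) k) c p := by
  rcases p with _ | ⟨x, i⟩
  · exact absurd hpk hkn.not_gt
  · exact (hL.le_coverage x).trans
      (coverage_le_coverage hL.nonneg fun I hx => Or.inl ⟨hpk, (x, i), rfl, hx⟩)

theorem coverage_layerPattern_eq_sum {p : ConeVertex V n} (hkp : k < height p)
    (hodd : Odd (height p + k)) (L : ι → Set V) (c : ι → ℝ) :
    coverage (fun i => layerPattern (L i) k) c p = ∑ i, c i :=
  coverage_eq_sum (fun _ => Or.inr ⟨hkp, hodd⟩) c

theorem odd_of_none_mem_layerPattern {I : Set V} {M : ℕ}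
    (hk : (none : ConeVertex V (2 * M)) ∈ layerPattern I k) : Odd k := by
  rcases hk with ⟨-, q, hq, -⟩ | ⟨-, hodd⟩
  · cases hq
  · exact (Nat.odd_add'.1 hodd).2 (even_two_mul M)

theorem mul_geom_le_of_odd_gap {s : ℝ} (hs : 0 ≤ s) {F : ℕ → ℝ} (hF : ∀ k, 0 ≤ F k) {d : ℕ}
    (hodd : ∀ k < d, Odd (d + k) → s + 1 ≤ F k) :
    (s + 1) * ∑ l ∈ Finset.range d, s ^ l ≤
      F 0 + (s + 1) * ∑ l ∈ Finset.range d, s ^ l * F (l + 1) := by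
  induction d using Nat.twoStepInduction with
  | zero => simpa using hF 0
  | one =>
    have h0 : s + 1 ≤ F 0 := hodd 0 one_pos odd_one
    have h1 : 0 ≤ (s + 1) * F 1 := mul_nonneg (by linarith) (hF 1)
    simp only [Finset.sum_range_one, pow_zero, mul_one, one_mul]
    linarith
  | more d ih _ =>
    have ih := ih fun k hk hdk => hodd k (by omega) (by grind)
    have hd : s + 1 ≤ F (d + 1) := hodd (d + 1) (by omega) (by grind)
    have hpair : (s + 1) * (s ^ d + s ^ (d + 1)) ≤
        (s + 1) * (s ^ d * F (d + 1) + s ^ (d + 1) * F (d + 2)) := by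
      refine mul_le_mul_of_nonneg_left ?_ (by linarith)
      calc s ^ d + s ^ (d + 1) = s ^ d * (s + 1) + 0 := by ring
        _ ≤ _ := add_le_add (mul_le_mul_of_nonneg_left hd (pow_nonneg hs d))
          (mul_nonneg (pow_nonneg hs _) (hF _))
    simp only [Finset.sum_range_succ, add_assoc] at hpair ⊢
    linarith

theorem mul_geom_le {s : ℝ} (hs : 0 ≤ s) {F : ℕ → ℝ} (hF : ∀ k, 0 ≤ F k) {d : ℕ} (hdn : d ≤ n)
    (hodd : ∀ k < d, Odd (d + k) → s + 1 ≤ F k) (hgt : ∀ k, d < k → k ≤ n → 1 ≤ F k) :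
    (s + 1) * ∑ l ∈ Finset.range n, s ^ l ≤
      F 0 + (s + 1) * ∑ l ∈ Finset.range n, s ^ l * F (l + 1) := by
  induction n, hdn using Nat.le_induction with
  | base => exact mul_geom_le_of_odd_gap hs hF hodd
  | succ n hdn ih =>
    have ih := ih fun k hdk hkn => hgt k hdk (by omega)
    have hn : s ^ n * 1 ≤ s ^ n * F (n + 1) :=
      mul_le_mul_of_nonneg_left (hgt (n + 1) (by omega) le_rfl) (pow_nonneg hs n)
    have := mul_le_mul_of_nonneg_left hn (show 0 ≤ s + 1 by linarith)
    simp only [Finset.sum_range_succ]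
    linarith

/-- The pairs of levels at which the two cones over a common base use the patterns `layerPattern`
simultaneously: `(0, 0)`, and `(2j + 1, 2j + 2)`, `(2j + 2, 2j + 1)`, `(2j + 2, 2j + 2)` for
`j < M`. -/
def levelPair {M : ℕ} : Option (Fin M × Fin 3) → Fin 2 → ℕ
  | none, _ => 0
  | some (j, r), v => 2 * j.val + !![1, 2; 2, 1; 2, 2] r v

/-- The weight of the pair `levelPair a`, chosen so that in each coordinate level `0` gets the
weight `1` and level `l + 1` the weight `(s + 1) * s ^ l`. -/
def levelPairWeight {M : ℕ} (s : ℝ) : Option (Fin M × Fin 3) → ℝ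
  | none => 1
  | some (j, r) => (s + 1) * s ^ (2 * j.val) * ![1, 1, s - 1] r

theorem levelPairWeight_nonneg {M : ℕ} {s : ℝ} (hs : 1 ≤ s) (a : Option (Fin M × Fin 3)) :
    0 ≤ levelPairWeight s a := by
  rcases a with _ | ⟨j, r⟩
  · exact zero_le_one
  · refine mul_nonneg (by positivity) ?_
    fin_cases r
    · exact zero_le_one
    · exact zero_le_one
    · exact sub_nonneg.2 hs

theorem levelPair_pos_iff {M : ℕ} {a : Option (Fin M × Fin 3)} {v : Fin 2} :
    0 < levelPair a v ↔ a ≠ none := by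
  rcases a with _ | ⟨j, r⟩
  · simp [levelPair]
  · fin_cases r <;> fin_cases v <;> simp [levelPair]

theorem not_odd_levelPair_of_ne {M : ℕ} {a : Option (Fin M × Fin 3)} {v v' : Fin 2} (hv : v ≠ v')
    (hodd : Odd (levelPair a v)) : ¬ Odd (levelPair a v') := by
  rcases a with _ | ⟨j, r⟩
  · simp [levelPair]
  · fin_cases r <;> fin_cases v <;> fin_cases v' <;>
      simp_all [levelPair, Nat.odd_iff]

theorem sum_levelPairWeight_mul (M : ℕ) (s : ℝ) (F : ℕ → ℝ) (v : Fin 2) :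
    ∑ a : Option (Fin M × Fin 3), levelPairWeight s a * F (levelPair a v) =
      F 0 + (s + 1) * ∑ l ∈ Finset.range (2 * M), s ^ l * F (l + 1) := by
  have hblock (j : Fin M) :
      ∑ r, levelPairWeight s (some (j, r)) * F (levelPair (some (j, r)) v) =
        (s + 1) * (s ^ (2 * j.val) * F (2 * j + 1) + s ^ (2 * j.val + 1) * F (2 * j + 2)) := by
    fin_cases v <;>
    · simp only [levelPairWeight, levelPair, Fin.sum_univ_three, Fin.zero_eta, Fin.mk_one,
        Matrix.of_apply, Matrix.cons_val]
      ring
  have hpairs (N : ℕ) : ∑ l ∈ Finset.range (2 * N), s ^ l * F (l + 1) =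
      ∑ j ∈ Finset.range N, (s ^ (2 * j) * F (2 * j + 1) + s ^ (2 * j + 1) * F (2 * j + 2)) := by
    induction N with
    | zero => simp
    | succ N ih =>
      rw [Nat.mul_succ, Finset.sum_range_succ, Finset.sum_range_succ, ih, Finset.sum_range_succ,
        add_assoc]
  rw [Fintype.sum_option, Fintype.sum_prod_type, Finset.sum_congr rfl fun j _ => hblock j,
    ← Finset.mul_sum, hpairs, Fin.sum_univ_eq_sum_range
      fun j => s ^ (2 * j) * F (2 * j + 1) + s ^ (2 * j + 1) * F (2 * j + 2)]
  simp [levelPairWeight, levelPair]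

theorem isFractionalCover_levelPair {L : ι → Set V} {φ : ι → ℝ} (hL : IsFractionalCover G L φ 1)
    {s : ℝ} (hs : 1 ≤ s) (hφ : ∑ i, φ i = s + 1) (M : ℕ) (v : Fin 2) :
    IsFractionalCover (cone G (2 * M))
      (fun p : Option (Fin M × Fin 3) × ι => layerPattern (L p.2) (levelPair p.1 v))
      (fun p => levelPairWeight s p.1 * φ p.2) ((s + 1) * ∑ l ∈ Finset.range (2 * M), s ^ l) where
  isIndepSet p := isIndepSet_layerPattern (hL.isIndepSet p.2) _
  nonneg p := mul_nonneg (levelPairWeight_nonneg hs p.1) (hL.nonneg p.2)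
  le_coverage p := by
    rw [coverage_mul, sum_levelPairWeight_mul M s
      (fun k => coverage (fun i => layerPattern (L i) k) φ p) v]
    exact mul_geom_le (zero_le_one.trans hs) (fun k => coverage_nonneg hL.nonneg _ p) (height_le p)
      (fun k hkp hodd => hφ ▸ (coverage_layerPattern_eq_sum hkp hodd L φ).ge)
      fun k hpk hkn => hL.le_coverage_layerPattern hpk hkn

theorem fracChromatic_hCone_top_le [Fintype V] {s : ℝ} (hs : 1 ≤ s) (hG : fracChromatic G = s + 1)
    {M : ℕ} (hM : 0 < M) :
    fracChromatic (hCone G ⊤ fun _ : Fin 2 => 2 * M) ≤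
      s + 1 + (∑ l ∈ Finset.range (2 * M), s ^ l)⁻¹ := by
  obtain ⟨ι, _, L, φ, hφ, hsum⟩ := exists_isFractionalCover_sum_eq_fracChromatic G
  rw [hG] at hsum
  set σ := ∑ l ∈ Finset.range (2 * M), s ^ l
  have hσ : 0 < σ := geom_sum_pos (zero_le_one.trans hs) (by omega)
  have htotal : ∑ a : Option (Fin M × Fin 3), levelPairWeight s a = 1 + (s + 1) * σ := by
    simpa using sum_levelPairWeight_mul M s (fun _ => 1) 0
  have hglue := mul_fracChromatic_hCone_le_sum (H := ⊤) (h := fun _ : Fin 2 => 2 * M)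
    (B := fun p => {x | p.1 ≠ none ∧ x ∈ L p.2}) (fun _ => by omega)
    (mul_pos (by linarith) hσ) (isFractionalCover_levelPair hφ hs hsum M)
    (fun v p x hv => by simp [layerPattern, height, levelPair_pos_iff])
    (fun v v' p hvv' hv hv' => not_odd_levelPair_of_ne hvv' (odd_of_none_mem_layerPattern hv)
      (odd_of_none_mem_layerPattern hv'))
  rw [Fintype.sum_prod_type, ← Finset.sum_mul_sum, htotal, hsum] at hglue
  refine le_of_mul_le_mul_left (hglue.trans_eq ?_) (show 0 < (s + 1) * σ by positivity)
  field_simp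
  ring

end UpperBound

section LowerBound

variable {V : Type*} {G : SimpleGraph V} {n N : ℕ}

/-- The layers of the `n`-th cone in which the set `J` contains the copy of `x`. -/
def levels (J : Set (ConeVertex V n)) (x : V) : Set ℕ :=
  {i | ∃ hi : i < n, some (x, ⟨i, hi⟩) ∈ J}

theorem not_adj_of_mem_levels {J : Set (ConeVertex V n)} (hJ : (cone G n).IsIndepSet J) {x y : V}
    {i j : ℕ} (hi : i ∈ levels J x) (hj : j ∈ levels J y)
    (hij : i + 1 = j ∨ j + 1 = i ∨ i = 0 ∧ j = 0) : ¬ G.Adj x y := by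
  obtain ⟨hin, hi⟩ := hi
  obtain ⟨hjn, hj⟩ := hj
  intro hxy
  have hadj : (cone G n).Adj (some (x, ⟨i, hin⟩)) (some (y, ⟨j, hjn⟩)) := ⟨hxy, hij⟩
  exact hJ hi hj hadj.ne hadj

theorem notMem_levels_of_none_mem {J : Set (ConeVertex V (N + 1))}
    (hJ : (cone G (N + 1)).IsIndepSet J) (hapex : none ∈ J) (x : V) : N ∉ levels J x := by
  rintro ⟨hN, hx⟩
  have hadj : (cone G (N + 1)).Adj (some (x, ⟨N, hN⟩)) none := rfl
  exact hJ hx hapex hadj.ne hadj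

/-- The positive members of `A` neither of whose neighbours belongs to `A`. The number `0` is never
isolated because the base layer of a cone is joined to itself. -/
def isolatedPoints (A : Set ℕ) : Set ℕ :=
  {l | l ∈ A ∧ l ≠ 0 ∧ l - 1 ∉ A ∧ l + 1 ∉ A}

/-- The independent set of `G` extracted from the layers `l` and `l + 1` of an independent set `J`
of the cone: the vertices with a nonisolated level `l`, together with the vertices of `I` having
the level `l` or `l + 1`. -/
def levelSlice (J : Set (ConeVertex V n)) (I : Set V) (l : ℕ) : Set V :=
  {x | (l ∈ levels J x ∧ l ∉ isolatedPoints (levels J x)) ∨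
    (x ∈ I ∧ (l ∈ levels J x ∨ l + 1 ∈ levels J x))}

theorem isIndepSet_levelSlice {J : Set (ConeVertex V n)} (hJ : (cone G n).IsIndepSet J) {I : Set V}
    (hI : G.IsIndepSet I) (l : ℕ) : G.IsIndepSet (levelSlice J I l) := by
  have hnonisolated {x y : V} (hx : l ∈ levels J x) (hx' : l ∉ isolatedPoints (levels J x))
      (hy : l ∈ levels J y ∨ l + 1 ∈ levels J y) : ¬ G.Adj x y := by
    rcases hy with hy | hy
    · have hneighbour : l = 0 ∨ l - 1 ∈ levels J x ∨ l + 1 ∈ levels J x := by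
        by_contra! hne
        exact hx' ⟨hx, hne⟩
      rcases hneighbour with rfl | hpred | hsucc
      · exact not_adj_of_mem_levels hJ hx hy (Or.inr (Or.inr ⟨rfl, rfl⟩))
      · exact not_adj_of_mem_levels hJ hpred hy (by omega)
      · exact not_adj_of_mem_levels hJ hsucc hy (Or.inr (Or.inl rfl))
    · exact not_adj_of_mem_levels hJ hx hy (Or.inl rfl)
  rintro x (⟨hx, hx'⟩ | ⟨hxI, hx⟩) y (⟨hy, hy'⟩ | ⟨hyI, hy⟩) hne hxy
  · exact hnonisolated hx hx' (Or.inl hy) hxy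
  · exact hnonisolated hx hx' hy hxy
  · exact hnonisolated hy hy' hx hxy.symm
  · exact hI hxI hyI hne hxy

theorem mul_indicator_add_isolatedPoints_le {s : ℝ} {A : Set ℕ} {U : ℕ → ℝ} (hU : ∀ l, 0 ≤ U l)
    (hmem : ∀ l, l ∈ A ∨ l + 1 ∈ A → 1 ≤ U l)
    (hnonisolated : ∀ l ∈ A, l ∉ isolatedPoints A → s + 1 ≤ U l) (l : ℕ) :
    (s + 1) * A.indicator 1 l +
      ((isolatedPoints A).indicator 1 (l + 1) - s * (isolatedPoints A).indicator 1 l) ≤ U l := by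
  by_cases hl : l ∈ A
  · have hsucc : l + 1 ∉ isolatedPoints A := fun h => h.2.2.1 hl
    by_cases hiso : l ∈ isolatedPoints A
    · simpa [hl, hsucc, hiso] using hmem l (Or.inl hl)
    · simpa [hl, hsucc, hiso] using hnonisolated l hl hiso
  · have hiso : l ∉ isolatedPoints A := fun h => hl h.1
    by_cases hsucc : l + 1 ∈ isolatedPoints A
    · simpa [hl, hsucc, hiso] using hmem l (Or.inr hsucc.1)
    · simpa [hl, hsucc, hiso] using hU l

theorem sum_pow_mul_sub_mul_eq_zero (s : ℝ) {g : ℕ → ℝ} (hg : g 0 = 0) (hgN : g (N + 1) = 0) :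
    ∑ l ∈ Finset.range (N + 1), s ^ (N - l) * (g (l + 1) - s * g l) = 0 := by
  have hsub : ∀ l ∈ Finset.range (N + 1), s ^ (N - l) * (g (l + 1) - s * g l) =
      s ^ (N + 1 - (l + 1)) * g (l + 1) - s ^ (N + 1 - l) * g l := fun l hl => by
    rw [Nat.add_sub_add_right, Nat.sub_add_comm (Finset.mem_range_succ_iff.1 hl), pow_succ]
    ring
  rw [Finset.sum_congr rfl hsub, Finset.sum_range_sub fun l => s ^ (N + 1 - l) * g l, hg, hgN]
  ring

theorem mul_sum_pow_mul_indicator_le {s : ℝ} (hs : 0 ≤ s) {A : Set ℕ} (hA : N + 1 ∉ A)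
    {U : ℕ → ℝ} (hU : ∀ l, 0 ≤ U l) (hmem : ∀ l, l ∈ A ∨ l + 1 ∈ A → 1 ≤ U l)
    (hnonisolated : ∀ l ∈ A, l ∉ isolatedPoints A → s + 1 ≤ U l) :
    (s + 1) * ∑ l ∈ Finset.range (N + 1), s ^ (N - l) * A.indicator 1 l ≤
      ∑ l ∈ Finset.range (N + 1), s ^ (N - l) * U l := by
  let g : ℕ → ℝ := (isolatedPoints A).indicator 1
  have hzero : ∑ l ∈ Finset.range (N + 1), s ^ (N - l) * (g (l + 1) - s * g l) = 0 :=
    sum_pow_mul_sub_mul_eq_zero s (Set.indicator_of_notMem (fun h => h.2.1 rfl) _)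
      (Set.indicator_of_notMem (fun h => hA h.1) _)
  calc (s + 1) * ∑ l ∈ Finset.range (N + 1), s ^ (N - l) * A.indicator 1 l
    _ = ∑ l ∈ Finset.range (N + 1),
          s ^ (N - l) * ((s + 1) * A.indicator 1 l + (g (l + 1) - s * g l)) := by
      simp only [mul_add (s ^ _), Finset.sum_add_distrib, hzero, add_zero, Finset.mul_sum,
        mul_left_comm (s ^ _)]
    _ ≤ _ := Finset.sum_le_sum fun l _ => mul_le_mul_of_nonneg_left
      (mul_indicator_add_isolatedPoints_le hU hmem hnonisolated l) (pow_nonneg hs _)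

theorem mul_sum_pow_mul_indicator_levels_le {ι : Type*} [Fintype ι] {L : ι → Set V} {φ : ι → ℝ}
    (hL : IsFractionalCover G L φ 1) {s : ℝ} (hs : 0 ≤ s) (hφ : ∑ i, φ i = s + 1)
    (J : Set (ConeVertex V (N + 1))) (x : V) :
    (s + 1) * ∑ l ∈ Finset.range (N + 1), s ^ (N - l) * (levels J x).indicator 1 l ≤
      ∑ l ∈ Finset.range (N + 1),
        s ^ (N - l) * coverage (fun i => levelSlice J (L i) l) φ x := by
  refine mul_sum_pow_mul_indicator_le hs (fun h => h.1.false)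
    (fun l => coverage_nonneg hL.nonneg _ x) (fun l hl => ?_) fun l hl hiso => ?_
  · exact (hL.le_coverage x).trans
      (coverage_le_coverage hL.nonneg fun i hi => Or.inr ⟨hi, hl⟩)
  · have hx (i : ι) : x ∈ levelSlice J (L i) l := Or.inl ⟨hl, hiso⟩
    exact hφ ▸ (coverage_eq_sum hx φ).ge

open Classical in
/-- The weight of the slice of `J` at the layers `l` and `l + 1`. For a set `J` containing the apex
the slice at the top layer `N` is empty, so that its weight can be saved. -/
noncomputable def sliceWeight (s : ℝ) (J : Set (ConeVertex V (N + 1))) (l : ℕ) : ℝ :=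
  if l = N ∧ none ∈ J then 0 else s ^ (N - l)

theorem sliceWeight_nonneg {s : ℝ} (hs : 0 ≤ s) (J : Set (ConeVertex V (N + 1))) (l : ℕ) :
    0 ≤ sliceWeight s J l := by
  rw [sliceWeight]
  split_ifs
  · exact le_rfl
  · exact pow_nonneg hs _

theorem sum_sliceWeight (s : ℝ) (J : Set (ConeVertex V (N + 1))) :
    ∑ l ∈ Finset.range (N + 1), sliceWeight s J l =
      ∑ l ∈ Finset.range (N + 1), s ^ l - J.indicator 1 none := by
  have hlt : ∀ l ∈ Finset.range N, sliceWeight s J l = s ^ (N - l) := fun l hl =>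
    if_neg fun h => (Finset.mem_range.1 hl).ne h.1
  rw [← Finset.sum_range_reflect (s ^ ·), Nat.add_sub_cancel, Finset.sum_range_succ,
    Finset.sum_range_succ, Finset.sum_congr rfl hlt]
  by_cases hJ : none ∈ J <;> simp [sliceWeight, hJ]

theorem sliceWeight_mul_coverage {ι : Type*} [Fintype ι] {J : Set (ConeVertex V (N + 1))}
    (hJ : (cone G (N + 1)).IsIndepSet J) (s : ℝ) (L : ι → Set V) (φ : ι → ℝ) (x : V) (l : ℕ) :
    sliceWeight s J l * coverage (fun i => levelSlice J (L i) l) φ x =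
      s ^ (N - l) * coverage (fun i => levelSlice J (L i) l) φ x := by
  by_cases hl : l = N ∧ none ∈ J
  · obtain ⟨rfl, hapex⟩ := hl
    have hlevel : l ∉ levels J x := notMem_levels_of_none_mem hJ hapex x
    have hlevel' : l + 1 ∉ levels J x := fun h => h.1.false
    simp [coverage, levelSlice, hlevel, hlevel']
  · rw [sliceWeight, if_neg hl]

theorem isFractionalCover_levelSlice {ι κ : Type*} [Fintype ι] [Fintype κ]
    {K : ι → Set (ConeVertex V (N + 1))} {f : ι → ℝ} (hK : IsFractionalCover (cone G (N + 1)) K f 1)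
    {L : κ → Set V} {φ : κ → ℝ} (hL : IsFractionalCover G L φ 1) {s : ℝ} (hs : 0 ≤ s)
    (hφ : ∑ j, φ j = s + 1) :
    IsFractionalCover G
      (fun p : (ι × Fin (N + 1)) × κ => levelSlice (K p.1.1) (L p.2) p.1.2)
      (fun p => f p.1.1 * sliceWeight s (K p.1.1) p.1.2 * φ p.2)
      ((s + 1) * ∑ l ∈ Finset.range (N + 1), s ^ l) where
  isIndepSet p := isIndepSet_levelSlice (hK.isIndepSet p.1.1) (hL.isIndepSet p.2) _
  nonneg p := mul_nonneg (mul_nonneg (hK.nonneg _) (sliceWeight_nonneg hs _ _)) (hL.nonneg _)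
  le_coverage x := by
    have hlevels : ∀ l ∈ Finset.range (N + 1), 1 ≤ coverage (fun i => levels (K i) x) f l :=
      fun l hl => (hK.le_coverage (some (x, ⟨l, Finset.mem_range.1 hl⟩))).trans
        (coverage_le_coverage hK.nonneg fun i hi => ⟨Finset.mem_range.1 hl, hi⟩)
    calc (s + 1) * ∑ l ∈ Finset.range (N + 1), s ^ l
      _ = (s + 1) * ∑ l ∈ Finset.range (N + 1), s ^ (N - l) * 1 := by
        simp only [mul_one, ← Finset.sum_range_reflect (s ^ ·) (N + 1), Nat.add_sub_cancel]
      _ ≤ (s + 1) * ∑ l ∈ Finset.range (N + 1),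
            s ^ (N - l) * coverage (fun i => levels (K i) x) f l := by
        gcongr with l hl
        exact hlevels l hl
      _ = ∑ i, f i * ((s + 1) * ∑ l ∈ Finset.range (N + 1),
            s ^ (N - l) * (levels (K i) x).indicator 1 l) := by
        simp only [coverage, Finset.mul_sum]
        rw [Finset.sum_comm]
        exact Finset.sum_congr rfl fun i _ => Finset.sum_congr rfl fun l _ => by ring
      _ ≤ ∑ i, f i * ∑ l ∈ Finset.range (N + 1),
            s ^ (N - l) * coverage (fun j => levelSlice (K i) (L j) l) φ x := by
        gcongr with i
        · exact hK.nonneg i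
        · exact mul_sum_pow_mul_indicator_levels_le hL hs hφ (K i) x
      _ = _ := by
        rw [coverage_mul _ (fun p : ι × Fin (N + 1) => f p.1 * sliceWeight s (K p.1) p.2),
          Fintype.sum_prod_type]
        refine Finset.sum_congr rfl fun i _ => ?_
        rw [← Fin.sum_univ_eq_sum_range fun l =>
          s ^ (N - l) * coverage (fun j => levelSlice (K i) (L j) l) φ x, Finset.mul_sum]
        exact Finset.sum_congr rfl fun l _ => by
          rw [← sliceWeight_mul_coverage (hK.isIndepSet i), mul_assoc]

theorem sum_levelSlice_weights_le {ι κ : Type*} [Fintype ι] [Fintype κ]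
    {K : ι → Set (ConeVertex V (N + 1))} {f : ι → ℝ} (hK : IsFractionalCover (cone G (N + 1)) K f 1)
    (φ : κ → ℝ) (hφ : 0 ≤ ∑ j, φ j) (s : ℝ) :
    ∑ p : (ι × Fin (N + 1)) × κ, f p.1.1 * sliceWeight s (K p.1.1) p.1.2 * φ p.2 ≤
      ((∑ i, f i) * ∑ l ∈ Finset.range (N + 1), s ^ l - 1) * ∑ j, φ j := by
  have hweight (i : ι) : ∑ l : Fin (N + 1), f i * sliceWeight s (K i) l =
      f i * ∑ l ∈ Finset.range (N + 1), s ^ l - f i * (K i).indicator 1 none := by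
    rw [← Finset.mul_sum, Fin.sum_univ_eq_sum_range (sliceWeight s (K i)), sum_sliceWeight,
      mul_sub]
  rw [Fintype.sum_prod_type]
  simp only [← Finset.mul_sum, ← Finset.sum_mul]
  refine mul_le_mul_of_nonneg_right ?_ hφ
  rw [Fintype.sum_prod_type, Finset.sum_congr rfl fun i _ => hweight i, Finset.sum_sub_distrib,
    ← Finset.sum_mul]
  exact sub_le_sub_left (hK.le_coverage none) _

theorem add_inv_geom_le_fracChromatic_cone [Fintype V] {s : ℝ} (hs : 0 ≤ s)
    (hG : fracChromatic G = s + 1) (N : ℕ) :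
    s + 1 + (∑ l ∈ Finset.range (N + 1), s ^ l)⁻¹ ≤ fracChromatic (cone G (N + 1)) := by
  obtain ⟨ι, _, K, f, hK, hf⟩ := exists_isFractionalCover_sum_eq_fracChromatic (cone G (N + 1))
  obtain ⟨κ, _, L, φ, hL, hφ⟩ := exists_isFractionalCover_sum_eq_fracChromatic G
  rw [hG] at hφ
  have hs' : 0 < s + 1 := by linarith
  have hσ : 0 < ∑ l ∈ Finset.range (N + 1), s ^ l := geom_sum_pos hs N.succ_ne_zero
  have hcover := ((isFractionalCover_levelSlice hK hL hs hφ).mul_fracChromatic_le_sum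
    (mul_pos hs' hσ)).trans (sum_levelSlice_weights_le hK φ (hφ ▸ hs'.le) s)
  rw [hG, hf, hφ, mul_assoc, mul_comm (s + 1)] at hcover
  have hle := le_of_mul_le_mul_right hcover hs'
  refine le_of_mul_le_mul_right ?_ hσ
  rw [add_mul, inv_mul_cancel₀ hσ.ne']
  linarith

end LowerBound

theorem fracChromatic_hCone_top_le_cone {V : Type*} [Fintype V] {G : SimpleGraph V} {x y : V}
    (hxy : G.Adj x y) {n : ℕ} (hn : 1 ≤ n) (heven : Even n) :
    fracChromatic (hCone G ⊤ fun _ : Fin 2 => n) ≤ fracChromatic (cone G n) := by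
  obtain ⟨M, rfl⟩ := even_iff_two_dvd.1 heven
  obtain ⟨N, hN⟩ := Nat.exists_eq_add_of_le' hn
  have hs : 1 ≤ fracChromatic G - 1 := by linarith [two_le_fracChromatic hxy]
  have hG : fracChromatic G = fracChromatic G - 1 + 1 := (sub_add_cancel _ _).symm
  refine (fracChromatic_hCone_top_le hs hG (M := M) (by omega)).trans ?_
  rw [hN]
  exact add_inv_geom_le_fracChromatic_cone (zero_le_one.trans hs) hG N

end GeneralizedCone

open GeneralizedCone in
theorem theorem9_general {V W : Type*} [Fintype V] [Fintype W] (G : SimpleGraph V)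
    (hG : ∃ x y : V, G.Adj x y) (H : SimpleGraph W) (κ : H.Coloring (Fin 2)) (n : ℕ) (hn : 1 ≤ n)
    (h : W → ℕ) (h_le : ∀ v, n ≤ h v) (h_min : ∃ v, h v = n)
    (h_parity : Even n ∨ ∀ v, κ v = 1 → h v ≠ n) :
    fracChromatic (hCone G H h) = fracChromatic (cone G n) := by
  obtain ⟨x, y, hxy⟩ := hG
  have : Nonempty V := ⟨x⟩
  apply le_antisymm
  · rcases h_parity with heven | hne
    · exact (fracChromatic_le_of_hom (hConeMap G κ (fun _ => hn) h_le)).trans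
        (fracChromatic_hCone_top_le_cone hxy hn heven)
    · have hle (v : W) : n + (κ v).val ≤ h v := by
        have := h_le v
        have := hne v
        omega
      exact (fracChromatic_le_of_hom (hConeToPendant G κ hn hle)).trans
        (fracChromatic_addPendant_le (two_le_fracChromatic_cone G hn) none)
  · obtain ⟨v, rfl⟩ := h_min
    exact fracChromatic_le_of_hom (glueHom G H h v)

theorem theorem9 {V : Type*} [Fintype V] (G : SimpleGraph V) (hG : ∃ x y : V, G.Adj x y)
    (n : ℕ) (hn : 1 ≤ n) (h : Fin 2 → ℕ) (h_first : h 0 = n) (h_second : n ≤ h 1)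
    (h_const : h 1 = n → Even n) :
    GeneralizedCone.fracChromatic
        (GeneralizedCone.hCone G (SimpleGraph.completeGraph (Fin 2)) h) =
      GeneralizedCone.fracChromatic (GeneralizedCone.cone G n) :=
  theorem9_general G hG _ (SimpleGraph.selfColoring _) n hn h
    (Fin.forall_fin_two.2 ⟨h_first.ge, h_second⟩) ⟨0, h_first⟩
    ((em (Even n)).imp_right fun hodd _ hv hn => hodd (h_const (hv ▸ hn)))
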